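/- For a metric space $(\mathcal X,\mathcal D)$, the doubling constant is the least $N$ such that every closed ball of radius $r>0$ is covered by $N$ closed balls of radius $r/2$; the space is doubling if $N<\infty$, and its doubling dimension is $\log_2 N$. A function $f:\mathcal X\to\mathbb R$ is nondegenerate with parameters $(\lambda,L,q)$, where $L\ge\lambda>0$ and $q\ge 1$, if it has a unique minimizer $x^*$ and $\lambda\,\mathcal D(x,x^*)^q\le f(x)-f(x^*)\le L\,\mathcal D(x,x^*)^q$ for all $x\in\mathcal X$. A policy $\pi$ chooses, at each step $t$, a point $x_t\in\mathcal X$ (deterministically or at random) on the basis of all past choices and observations $x_1,y_1,\dots,x_{t-1},y_{t-1}$ (there is no communication constraint); on the instance with measurable mean loss $f$ and standard Gaussian noise it then observes $y_t\sim\mathcal N(f(x_t),1)$. Its regret is $R^\pi(T)=\sum_{t=1}^T\big(f(x_t)-f(x^*)\big)$. There is an absolute constant $A_->1$, and for every $q\ge1$ there are constants $K_->0$ and $L\ge\lambda>0$, depending only on $q$, such that the following holds. For every real $d\ge1$ there is a compact doubling metric space $\mathcal X_0\subset(\mathbb R^{\lfloor d\rfloor},\|\cdot\|_\infty)$ of doubling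 dimension $\lfloor d\rfloor$ such that, for every $T\in\mathbb N_+$ and every policy $\pi$ on $\mathcal X_0$, there is an instance with standard Gaussian noise whose mean loss $f$ is nondegenerate on $\mathcal X_0$ with parameters $(\lambda,L,q)$ and on which $$\mathbb E\big[R^\pi(T)\big]\ \ge\ K_-\,A_-^{\lfloor d\rfloor}\sqrt T .$$ -/

import Mathlib

open MeasureTheory ProbabilityTheory

namespace NondegBandit

/-- Every closed ball of `X` of positive radius `r` is covered by at most `N` closed balls of
radius `r / 2` (centred at points of `X`). -/
def HalvingCover (X : Type*) [PseudoMetricSpace X] (N : ℕ) : Prop :=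
  ∀ (x : X) (r : ℝ), 0 < r →
    ∃ C : Finset X, C.card ≤ N ∧ Metric.closedBall x r ⊆ ⋃ c ∈ C, Metric.closedBall c (r / 2)

/-- `X` is a doubling space: its doubling constant is finite. -/
def IsDoubling (X : Type*) [PseudoMetricSpace X] : Prop :=
  ∃ N : ℕ, HalvingCover X N

/-- The doubling constant: the least `N` with `HalvingCover X N`
(meaningful when `IsDoubling X`). -/
noncomputable def doublingConstant (X : Type*) [PseudoMetricSpace X] : ℕ :=
  sInf {N : ℕ | HalvingCover X N}

/-- The doubling dimension `log₂ N`, with `N` the doubling constant. -/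
noncomputable def doublingDim (X : Type*) [PseudoMetricSpace X] : ℝ :=
  Real.logb 2 (doublingConstant X)

/-- `f` is a nondegenerate function with unique minimizer `xs` and nondegenerate parameters
`L ≥ lam > 0` and `q ≥ 1`. -/
structure IsNondegenerate {X : Type*} [PseudoMetricSpace X] (f : X → ℝ) (xs : X)
    (lam L q : ℝ) : Prop where
  lam_pos : 0 < lam
  lam_le : lam ≤ L
  one_le_q : 1 ≤ q
  unique_min : ∀ x, x ≠ xs → f xs < f x
  lower : ∀ x, lam * dist x xs ^ q ≤ f x - f xs
  upper : ∀ x, f x - f xs ≤ L * dist x xs ^ q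

/-- The observations `(x₁, y₁), …, (x_t, y_t)` made in the first `t` steps. -/
abbrev History (X : Type*) (t : ℕ) : Type _ := Fin t → X × ℝ

/-- A (possibly randomized) policy: after `t` steps, the next choice is drawn from a probability
distribution on `X` that depends measurably on all `t` past choices and observed losses.
A deterministic policy is the case of Dirac kernels. -/
structure Policy (X : Type*) [MeasurableSpace X] where
  act : (t : ℕ) → Kernel (History X t) X
  markov : ∀ t, IsMarkovKernel (act t)

attribute [instance] Policy.markov

/-- The law `𝒩(f x, 1)` of the observed loss at `x`, as a kernel. -/
noncomputable def lossKernel {X : Type*} [MeasurableSpace X] (f : X → ℝ) (hf : Measurable f) :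
    Kernel X ℝ where
  toFun x := gaussianReal (f x) 1
  measurable' := measurable_gaussianReal.comp (hf.prodMk measurable_const)

instance isMarkovKernel_lossKernel {X : Type*} [MeasurableSpace X] (f : X → ℝ)
    (hf : Measurable f) : IsMarkovKernel (lossKernel f hf) :=
  ⟨fun x => inferInstanceAs (IsProbabilityMeasure (gaussianReal (f x) 1))⟩

/-- Append the pair observed in a new step at the end of a history. -/
def appendStep {X : Type*} {t : ℕ} (p : History X t × (X × ℝ)) : History X (t + 1) :=
  Fin.snoc (α := fun _ => X × ℝ) p.1 p.2

/-- The law of `(x₁, y₁), …, (x_t, y_t)` when the policy `π` is run on the loss `f`: given the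
past, `x_{t+1}` is drawn from the policy, and then `y_{t+1}` from `𝒩(f x_{t+1}, 1)`. -/
noncomputable def historyLaw {X : Type*} [MeasurableSpace X] (π : Policy X) (f : X → ℝ)
    (hf : Measurable f) : (t : ℕ) → Measure (History X t)
  | 0 => Measure.dirac Fin.elim0
  | t + 1 => (historyLaw π f hf t ⊗ₘ
      (π.act t ⊗ₖ Kernel.prodMkLeft (History X t) (lossKernel f hf))).map appendStep

/-- The regret `∑_{t=1}^T (f x_t - f x*)` along a history of length `T`. -/
def regret {X : Type*} (f : X → ℝ) (xs : X) {T : ℕ} (h : History X T) : ℝ :=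
  ∑ t : Fin T, (f (h t).1 - f xs)

/-- The expected `T`-step regret of the policy `π` on the loss `f`. -/
noncomputable def expectedRegret {X : Type*} [MeasurableSpace X] (π : Policy X) (f : X → ℝ)
    (hf : Measurable f) (xs : X) (T : ℕ) : ℝ :=
  ∫ h, regret f xs h ∂(historyLaw π f hf T)

theorem measurable_appendStep {X : Type*} [MeasurableSpace X] {t : ℕ} :
    Measurable (appendStep : History X t × (X × ℝ) → History X (t + 1)) := by
  refine measurable_pi_lambda _ fun i => ?_
  refine Fin.lastCases ?_ (fun j => ?_) i
  · simpa [appendStep] using measurable_snd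
  · simpa [appendStep, Function.comp_def] using (measurable_pi_apply j).comp measurable_fst

instance isProbabilityMeasure_historyLaw {X : Type*} [MeasurableSpace X] (π : Policy X)
    (f : X → ℝ) (hf : Measurable f) (t : ℕ) : IsProbabilityMeasure (historyLaw π f hf t) := by
  induction t with
  | zero => unfold historyLaw; infer_instance
  | succ t ih =>
    unfold historyLaw
    exact Measure.isProbabilityMeasure_map measurable_appendStep.aemeasurable

end NondegBandit

/-!
The space is a cube in `ℝⁿ` with the sup norm, `n = ⌊d⌋₊`. A ball of radius `r` is covered by `2 ^ n`
balls of half the radius, one per orthant (`halvingCover_cube`), and no fewer suffice for the whole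
cube, since its `2 ^ n` corners are far apart (`two_pow_le_of_halvingCover_cube`).

The `2 ^ n` points with all coordinates `±ε` have norm `ε` and mutual distance at least `2 ε`. For
each of them, `p`, the loss `spikeLoss q ε p` equals `dist x p ^ q` on the ball of radius `ε` about
`p`, and the common reference loss `(ε + ‖x‖) ^ q` elsewhere. Off that ball, `ε + ‖x‖` lies between
`dist x p` and `3 * dist x p`, so the loss is nondegenerate with parameters `(1, 3 ^ q, q)`
(`isNondegenerate_spikeLoss`), whatever `n` and `ε` are. To have small regret, a policy must find the
right one of the `2 ^ n` disjoint balls, on each of which the loss differs from the reference loss by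
at most `δ = 3 ^ q * ε ^ q`.

Run on the reference loss, the policy visits one of the balls at most `T / 2 ^ n` times in
expectation (`exists_integral_visits_le`). The laws of the history under the reference loss and under
the loss with the spike in that ball are mutually absolutely continuous, with an explicit density
(`lintegral_historyLaw_eq`), and their relative entropy is at most `δ ^ 2 / 2` per visit
(`integral_sum_logRatio_ge`). So the visits under the second law are not many more
(`integral_visits_le`, in which an elementary inequality takes the place of Pinsker's). With `ε ^ q`
proportional to `√(2 ^ n / T)`, the relative entropy is at most `1 / 32`, and an eighth of the steps
or more is spent outside the ball, each at a cost of at least `ε ^ q`. The total is of the order of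
`√(2 ^ n * T)`. The side of the cube is chosen such that this scale fits in even for `T = 1`.
-/

namespace NondegBandit

open scoped ENNReal

/-! ### The law of the history and the change of measure -/

section Law

variable {X : Type*} [MeasurableSpace X]

theorem lintegral_historyLaw_succ (π : Policy X) (f : X → ℝ) (hf : Measurable f) (t : ℕ)
    {G : History X (t + 1) → ℝ≥0∞} (hG : Measurable G) :
    ∫⁻ h, G h ∂(historyLaw π f hf (t + 1)) =
      ∫⁻ h, ∫⁻ x, ∫⁻ y, G (appendStep (h, (x, y))) ∂(gaussianReal (f x) 1) ∂(π.act t h)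
        ∂(historyLaw π f hf t) := by
  have hG' : Measurable fun p : History X t × (X × ℝ) => G (appendStep p) :=
    hG.comp measurable_appendStep
  rw [historyLaw, lintegral_map hG measurable_appendStep, Measure.lintegral_compProd hG']
  refine lintegral_congr fun h => ?_
  have hGh : Measurable fun b : X × ℝ => G (appendStep (h, b)) := hG'.comp measurable_prodMk_left
  rw [Kernel.lintegral_compProd _ _ _ hGh]
  rfl

/-- The law of the point chosen in step `t + 1`. -/
noncomputable def choiceLaw (π : Policy X) (f : X → ℝ) (hf : Measurable f) (t : ℕ) : Measure X :=
  (historyLaw π f hf t).bind (π.act t)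

instance isProbabilityMeasure_choiceLaw (π : Policy X) (f : X → ℝ) (hf : Measurable f) (t : ℕ) :
    IsProbabilityMeasure (choiceLaw π f hf t) := by
  unfold choiceLaw; infer_instance

/-- Forgetting the last step of a history of length `t + 1` gives a history of length `t`. -/
theorem measurePreserving_init (π : Policy X) (f : X → ℝ) (hf : Measurable f) (t : ℕ) :
    MeasurePreserving (fun h : History X (t + 1) => fun i : Fin t => h i.castSucc)
      (historyLaw π f hf (t + 1)) (historyLaw π f hf t) := by
  have hm : Measurable fun h : History X (t + 1) => fun i : Fin t => h i.castSucc := by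
    fun_prop
  refine ⟨hm, Measure.ext_of_lintegral _ fun G hG => ?_⟩
  have hGm : Measurable fun h : History X (t + 1) => G fun i : Fin t => h i.castSucc := hG.comp hm
  rw [lintegral_map hG hm, lintegral_historyLaw_succ _ _ _ _ hGm]
  simp [appendStep]

/-- In the last step, the observation depends on the past only through the point chosen. -/
theorem measurePreserving_last (π : Policy X) (f : X → ℝ) (hf : Measurable f) (t : ℕ) :
    MeasurePreserving (fun h : History X (t + 1) => h (Fin.last t))
      (historyLaw π f hf (t + 1)) (choiceLaw π f hf t ⊗ₘ lossKernel f hf) := by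
  have hm : Measurable fun h : History X (t + 1) => h (Fin.last t) := by fun_prop
  refine ⟨hm, Measure.ext_of_lintegral _ fun G hG => ?_⟩
  have hGm : Measurable fun h : History X (t + 1) => G (h (Fin.last t)) := hG.comp hm
  rw [lintegral_map hG hm, lintegral_historyLaw_succ _ _ _ _ hGm,
    Measure.lintegral_compProd hG, choiceLaw,
    Measure.lintegral_bind (π.act t).measurable.aemeasurable
      (Measurable.lintegral_kernel_prod_right' hG).aemeasurable]
  simp only [appendStep, Fin.snoc_last]
  rfl

/-- The expectation of a functional that adds up over the steps may be computed step by step, with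
each observation averaged out given the point chosen. -/
theorem integral_sum_historyLaw (π : Policy X) (f : X → ℝ) (hf : Measurable f)
    {φ : X × ℝ → ℝ} (hφ : ∀ ν : Measure X, IsProbabilityMeasure ν →
      Integrable φ (ν ⊗ₘ lossKernel f hf)) (T : ℕ) :
    Integrable (fun h : History X T => ∑ i, φ (h i)) (historyLaw π f hf T) ∧
      ∫ h, ∑ i, φ (h i) ∂(historyLaw π f hf T) =
        ∑ t ∈ Finset.range T, ∫ x, ∫ y, φ (x, y) ∂(gaussianReal (f x) 1) ∂(choiceLaw π f hf t) := by
  induction T with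
  | zero => simp
  | succ T ih =>
    have h0 := measurePreserving_init π f hf T
    have h1 := measurePreserving_last π f hf T
    have hi := hφ (choiceLaw π f hf T) inferInstance
    have i0 := h0.integrable_comp_of_integrable ih.1
    have i1 := h1.integrable_comp_of_integrable hi
    simp only [Fin.sum_univ_castSucc, Function.comp_def] at i0 i1 ⊢
    refine ⟨i0.add i1, ?_⟩
    rw [integral_add i0 i1, Finset.sum_range_succ]
    congr 1
    · rw [← ih.2, ← h0.map_eq, integral_map h0.aemeasurable]
      rw [h0.map_eq]
      exact ih.1.aestronglyMeasurable
    · rw [← integral_map (φ := fun h : History X (T + 1) => h (Fin.last T)) h1.aemeasurable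
        (by rw [h1.map_eq]; exact hi.aestronglyMeasurable), h1.map_eq,
        Measure.integral_compProd hi]
      rfl

/-- The logarithm of the likelihood ratio of `𝒩(f x, 1)` against `𝒩(g x, 1)`, at `y`. -/
noncomputable def logRatio (f g : X → ℝ) (p : X × ℝ) : ℝ :=
  (f p.1 - g p.1) * (p.2 - g p.1) - (f p.1 - g p.1) ^ 2 / 2

@[fun_prop]
theorem measurable_logRatio {f g : X → ℝ} (hf : Measurable f) (hg : Measurable g) :
    Measurable (logRatio f g) := by
  unfold logRatio; fun_prop

theorem lintegral_gaussianReal_eq (a b : ℝ) (G : ℝ → ℝ≥0∞) (hG : Measurable G) :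
    ∫⁻ y, G y ∂(gaussianReal a 1) =
      ∫⁻ y, G y * ENNReal.ofReal (Real.exp ((a - b) * (y - b) - (a - b) ^ 2 / 2))
        ∂(gaussianReal b 1) := by
  rw [gaussianReal_of_var_ne_zero _ one_ne_zero, gaussianReal_of_var_ne_zero _ one_ne_zero,
    lintegral_withDensity_eq_lintegral_mul _ (measurable_gaussianPDF _ _) hG,
    lintegral_withDensity_eq_lintegral_mul _ (measurable_gaussianPDF _ _) (by fun_prop)]
  refine lintegral_congr fun y => ?_
  have : gaussianPDF a 1 y = gaussianPDF b 1 y *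
      ENNReal.ofReal (Real.exp ((a - b) * (y - b) - (a - b) ^ 2 / 2)) := by
    rw [gaussianPDF, gaussianPDF, ← ENNReal.ofReal_mul (gaussianPDFReal_nonneg _ _ _)]
    simp only [gaussianPDFReal]
    rw [mul_assoc (b := Real.exp _), ← Real.exp_add]
    congr 3
    simp only [NNReal.coe_one]
    ring
  simp only [Pi.mul_apply, this]
  ring

/-- Change of measure: the law of the history under `f` has density `exp (∑ logRatio f g)` with
respect to its law under `g`. The policy contributes nothing to the density, since it reacts to the
past in the same way on both losses. -/
theorem lintegral_historyLaw_eq (π : Policy X) {f g : X → ℝ} (hf : Measurable f)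
    (hg : Measurable g) (T : ℕ) (G : History X T → ℝ≥0∞) (hG : Measurable G) :
    ∫⁻ h, G h ∂(historyLaw π f hf T) =
      ∫⁻ h, G h * ENNReal.ofReal (Real.exp (∑ i, logRatio f g (h i))) ∂(historyLaw π g hg T) := by
  induction T with
  | zero => simp [historyLaw]
  | succ T ih =>
    have hl := measurable_logRatio hf hg
    have hstep : Measurable fun p : (History X T × X) × ℝ => G (appendStep (p.1.1, (p.1.2, p.2))) :=
      hG.comp (measurable_appendStep.comp (by fun_prop))
    have hin : Measurable fun p : History X T × X =>
        ∫⁻ y, G (appendStep (p.1, (p.2, y))) ∂(gaussianReal (f p.2) 1) :=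
      Measurable.lintegral_kernel_prod_right' (κ := Kernel.prodMkLeft (History X T) (lossKernel f hf))
        hstep
    rw [lintegral_historyLaw_succ _ _ _ _ hG, lintegral_historyLaw_succ _ _ _ _ (by fun_prop),
      ih _ (Measurable.lintegral_kernel_prod_right' hin)]
    refine lintegral_congr fun h => ?_
    have hGh : Measurable fun p : X × ℝ => G (appendStep (h, p)) :=
      hG.comp (measurable_appendStep.comp measurable_prodMk_left)
    have hinh : Measurable fun x : X =>
        ∫⁻ y, G (appendStep (h, (x, y))) ∂(gaussianReal (f x) 1) :=
      Measurable.lintegral_kernel_prod_right' (κ := lossKernel f hf)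
        (f := fun p : X × ℝ => G (appendStep (h, p))) hGh
    rw [← lintegral_mul_const _ hinh]
    refine lintegral_congr fun x => ?_
    have hstepx : Measurable fun y : ℝ => G (appendStep (h, (x, y))) :=
      hstep.comp (measurable_prodMk_left (x := (h, x)))
    have hw : Measurable fun y : ℝ => G (appendStep (h, (x, y))) *
        ENNReal.ofReal (Real.exp ((f x - g x) * (y - g x) - (f x - g x) ^ 2 / 2)) :=
      hstepx.mul (by fun_prop)
    rw [lintegral_gaussianReal_eq (f x) (g x) _ hstepx, ← lintegral_mul_const _ hw]
    refine lintegral_congr fun y => ?_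
    have hsum : ∑ i, logRatio f g (appendStep (h, (x, y)) i) =
        ∑ i, logRatio f g (h i) + ((f x - g x) * (y - g x) - (f x - g x) ^ 2 / 2) := by
      simp only [Fin.sum_univ_castSucc, appendStep, Fin.snoc_castSucc, Fin.snoc_last, logRatio]
    rw [hsum, Real.exp_add, ENNReal.ofReal_mul (Real.exp_nonneg _), mul_assoc]
    congr 1
    exact mul_comm _ _

end Law

/-! ### Visits to a set -/

section Visits

variable {X : Type*}

/-- The number of steps in which the point chosen lies in `B`. -/
noncomputable def visits (B : Set X) {T : ℕ} (h : History X T) : ℝ :=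
  ∑ i, B.indicator (fun _ => (1 : ℝ)) (h i).1

theorem visits_nonneg (B : Set X) {T : ℕ} (h : History X T) : 0 ≤ visits B h :=
  Finset.sum_nonneg fun _ _ => Set.indicator_nonneg (fun _ _ => zero_le_one) _

theorem visits_le (B : Set X) {T : ℕ} (h : History X T) : visits B h ≤ T := by
  calc visits B h ≤ ∑ _i : Fin T, (1 : ℝ) :=
        Finset.sum_le_sum fun i _ => Set.indicator_le_self' (fun _ _ => zero_le_one) _
    _ = T := by simp

theorem sum_visits_le {ι : Type*} [Fintype ι] {B : ι → Set X}
    (hB : Pairwise fun v w => Disjoint (B v) (B w)) {T : ℕ} (h : History X T) :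
    ∑ v, visits (B v) h ≤ T := by
  unfold visits
  rw [Finset.sum_comm]
  calc _ ≤ ∑ _i : Fin T, (1 : ℝ) := Finset.sum_le_sum fun i _ => ?_
    _ = T := by simp
  rw [← Finset.indicator_biUnion_apply Finset.univ B fun v _ w _ hvw => hB hvw]
  exact Set.indicator_le_self' (fun _ _ => zero_le_one) _

end Visits

/-! ### Relative entropy and regret -/

section Law

variable {X : Type*} [MeasurableSpace X]

theorem integrable_logRatio_compProd {f g : X → ℝ} (hf : Measurable f) (hg : Measurable g) {δ : ℝ}
    (hδ : ∀ x, |f x - g x| ≤ δ) (ν : Measure X) [IsProbabilityMeasure ν] :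
    Integrable (logRatio f g) (ν ⊗ₘ lossKernel g hg) := by
  have hm : Integrable (fun p : X × ℝ => p.2 - g p.1) (ν ⊗ₘ lossKernel g hg) := by
    have hmeas : Measurable fun p : X × ℝ => p.2 - g p.1 := by fun_prop
    -- The absolute moment about the mean is the same for all means, hence bounded in `p.1`.
    have hmap : ∀ m : ℝ, ∫ y, ‖y - m‖ ∂(gaussianReal m 1) = ∫ y, ‖y‖ ∂(gaussianReal 0 1) := by
      intro m
      have h : (gaussianReal m 1).map (· - m) = gaussianReal 0 1 := by
        rw [gaussianReal_map_sub_const, sub_self]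
      rw [← h, integral_map (by fun_prop) (by fun_prop)]
    rw [Measure.integrable_compProd_iff hmeas.aestronglyMeasurable]
    refine ⟨Filter.Eventually.of_forall fun x => ?_, ?_⟩
    · exact ((memLp_id_gaussianReal 1).integrable le_rfl).sub (integrable_const (g x))
    · have : (fun x => ∫ y, ‖y - g x‖ ∂(lossKernel g hg x)) =
          fun _ => ∫ y, ‖y‖ ∂(gaussianReal 0 1) := funext fun x => hmap (g x)
      rw [this]
      exact integrable_const _
  have hd : Measurable fun p : X × ℝ => f p.1 - g p.1 := by fun_prop
  refine (hm.bdd_mul (c := δ) hd.aestronglyMeasurable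
    (Filter.Eventually.of_forall fun p => hδ p.1)).sub ?_
  refine Integrable.of_bound (C := δ ^ 2 / 2) (by fun_prop)
    (Filter.Eventually.of_forall fun p => ?_)
  rw [Real.norm_eq_abs, abs_of_nonneg (by positivity), ← sq_abs]
  have := hδ p.1
  gcongr

theorem integral_logRatio {Y : Type*} (f g : Y → ℝ) (x : Y) :
    ∫ y, logRatio f g (x, y) ∂(gaussianReal (g x) 1) = -((f x - g x) ^ 2 / 2) := by
  have hid : Integrable (fun y : ℝ => y) (gaussianReal (g x) 1) :=
    (memLp_id_gaussianReal 1).integrable le_rfl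
  simp only [logRatio]
  have hsub : Integrable (fun y : ℝ => y - g x) (gaussianReal (g x) 1) :=
    hid.sub (integrable_const _)
  rw [integral_sub (hsub.const_mul _) (integrable_const _),
    integral_const_mul, integral_sub hid (integrable_const _), integral_id_gaussianReal]
  simp

theorem measurable_visits {B : Set X} (hB : MeasurableSet B) {T : ℕ} :
    Measurable (visits B : History X T → ℝ) := by
  refine Finset.measurable_sum _ fun i _ => ?_
  exact (measurable_const.indicator hB).comp (by fun_prop)

theorem integrable_visits {B : Set X} (hB : MeasurableSet B) {T : ℕ} (μ : Measure (History X T))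
    [IsFiniteMeasure μ] : Integrable (visits B) μ :=
  Integrable.of_bound (C := T) (measurable_visits hB).aestronglyMeasurable
    (Filter.Eventually.of_forall fun h => by
      rw [Real.norm_eq_abs, abs_of_nonneg (visits_nonneg B h)]
      exact visits_le B h)

/-- The relative entropy of the two laws of the history is at most `δ² / 2` per visit to the set
where the losses differ. -/
theorem integral_sum_logRatio_ge (π : Policy X) {f g : X → ℝ} (hf : Measurable f)
    (hg : Measurable g) {B : Set X} (hB : MeasurableSet B) {δ : ℝ}
    (hδ : ∀ x, |f x - g x| ≤ δ) (hfg : ∀ x, x ∉ B → f x = g x) (T : ℕ) :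
    Integrable (fun h : History X T => ∑ i, logRatio f g (h i)) (historyLaw π g hg T) ∧
    -(δ ^ 2 / 2 * ∫ h, visits B h ∂(historyLaw π g hg T)) ≤
      ∫ h, ∑ i, logRatio f g (h i) ∂(historyLaw π g hg T) := by
  have h1 := integral_sum_historyLaw π g hg
    (fun ν _ => integrable_logRatio_compProd hf hg hδ ν) T
  have hindB : Measurable (B.indicator fun _ => (1 : ℝ)) := measurable_const.indicator hB
  have hind : ∀ (ν : Measure X), IsProbabilityMeasure ν →
      Integrable (B.indicator fun _ => (1 : ℝ)) ν := fun ν _ =>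
    (integrable_const _).indicator hB
  have h2 := integral_sum_historyLaw π g hg (φ := fun p => B.indicator (fun _ => (1 : ℝ)) p.1)
    (fun ν _ => Integrable.of_bound (C := 1) (hindB.comp measurable_fst).aestronglyMeasurable
      (Filter.Eventually.of_forall fun p => by
        by_cases h : p.1 ∈ B <;> simp [h])) T
  refine ⟨h1.1, ?_⟩
  unfold visits
  rw [h1.2, h2.2, Finset.mul_sum, ← Finset.sum_neg_distrib]
  refine Finset.sum_le_sum fun t _ => ?_
  simp only [integral_logRatio, integral_const, probReal_univ, one_smul]
  rw [← integral_const_mul, ← integral_neg]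
  have hsq : ∀ x, (f x - g x) ^ 2 ≤ δ ^ 2 := fun x => by
    rw [← sq_abs]; have := hδ x; gcongr
  refine integral_mono ((hind _ inferInstance).const_mul _).neg ?_ fun x => ?_
  · refine Integrable.of_bound (C := δ ^ 2 / 2) (by fun_prop)
      (Filter.Eventually.of_forall fun x => ?_)
    rw [norm_neg, Real.norm_eq_abs, abs_of_nonneg (by positivity)]
    linarith [hsq x]
  · by_cases h : x ∈ B
    · simpa [h] using by linarith [hsq x]
    · simp [h, hfg x h]

/-- Bounds the total variation distance of two laws by their relative entropy, through the density
`exp s`. The term `1 / 8 * (1 + exp s)` contributes only a constant once integrated. -/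
theorem abs_exp_sub_one_le (s : ℝ) :
    |Real.exp s - 1| ≤ 4 * (Real.exp s - 1 - s) + 1 / 8 * (1 + Real.exp s) := by
  have hs : Real.exp s = Real.exp (s / 2) ^ 2 := by
    rw [← Real.exp_nat_mul]; congr 1; push_cast; ring
  have h1 := Real.add_one_le_exp (s / 2)
  rw [hs]
  -- With `r = exp (s / 2)`, the first bracket is at least `(r - 1) ^ 2`, and `r ^ 2 - 1` factors as
  -- `(r - 1) * (r + 1)`, to which the arithmetic-geometric mean inequality applies.
  set r := Real.exp (s / 2)
  rw [abs_le]
  constructor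
  · nlinarith [sq_nonneg (2 * (r - 1) + (r + 1) / 4), sq_nonneg (r - 1)]
  · nlinarith [sq_nonneg (2 * (r - 1) - (r + 1) / 4), sq_nonneg (r - 1)]

/-- If a set `B` is visited rarely under `g`, then it is visited rarely under every loss that
differs from `g` on `B` only, and by little. -/
theorem integral_visits_le (π : Policy X) {f g : X → ℝ} (hf : Measurable f)
    (hg : Measurable g) {B : Set X} (hB : MeasurableSet B) {δ : ℝ}
    (hδ : ∀ x, |f x - g x| ≤ δ) (hfg : ∀ x, x ∉ B → f x = g x) (T : ℕ) :
    ∫ h, visits B h ∂(historyLaw π f hf T) ≤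
      ∫ h, visits B h ∂(historyLaw π g hg T) +
        T * (2 * δ ^ 2 * ∫ h, visits B h ∂(historyLaw π g hg T) + 1 / 4) := by
  obtain ⟨hS, hSge⟩ := integral_sum_logRatio_ge π hf hg hB hδ hfg T
  set P := historyLaw π g hg T
  set S : History X T → ℝ := fun h => ∑ i, logRatio f g (h i) with hSdef
  have hl := measurable_logRatio hf hg
  have hSm : Measurable S := by fun_prop
  have hE : ∫⁻ h, ENNReal.ofReal (Real.exp (S h)) ∂P = 1 := by
    have := lintegral_historyLaw_eq π hf hg T (fun _ => 1) measurable_const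
    simpa using this.symm
  have hEi : Integrable (fun h => Real.exp (S h)) P := by
    refine ⟨by fun_prop, ?_⟩
    rw [hasFiniteIntegral_iff_ofReal (Filter.Eventually.of_forall fun h => Real.exp_nonneg _), hE]
    exact ENNReal.one_lt_top
  have hE1 : ∫ h, Real.exp (S h) ∂P = 1 := by
    rw [integral_eq_lintegral_of_nonneg_ae (Filter.Eventually.of_forall fun h => Real.exp_nonneg _)
      (by fun_prop), hE, ENNReal.toReal_one]
  have hV := measurable_visits hB (T := T)
  have hchange : ∫ h, visits B h ∂(historyLaw π f hf T) =
      ∫ h, visits B h * Real.exp (S h) ∂P := by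
    rw [integral_eq_lintegral_of_nonneg_ae (Filter.Eventually.of_forall (visits_nonneg B))
        hV.aestronglyMeasurable,
      integral_eq_lintegral_of_nonneg_ae (Filter.Eventually.of_forall fun h =>
        mul_nonneg (visits_nonneg B h) (Real.exp_nonneg _)) (by fun_prop),
      lintegral_historyLaw_eq π hf hg T _ (by fun_prop)]
    simp only [ENNReal.ofReal_mul (visits_nonneg B _), hSdef, P]
  have hVi := integrable_visits hB P
  have hE1i : Integrable (fun h => Real.exp (S h) - 1) P := hEi.sub (integrable_const _)
  have hR1 : Integrable (fun h => Real.exp (S h) - 1 - S h) P := hE1i.sub hS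
  have hR2 : Integrable (fun h => 1 + Real.exp (S h)) P := (integrable_const _).add hEi
  have hR : Integrable (fun h => 4 * (Real.exp (S h) - 1 - S h) + 1 / 8 * (1 + Real.exp (S h))) P :=
    (hR1.const_mul _).add (hR2.const_mul _)
  rw [hchange]
  calc ∫ h, visits B h * Real.exp (S h) ∂P
      ≤ ∫ h, (visits B h + T * (4 * (Real.exp (S h) - 1 - S h) + 1 / 8 * (1 + Real.exp (S h)))) ∂P := by
        refine integral_mono (hEi.bdd_mul (c := T) hV.aestronglyMeasurable
          (Filter.Eventually.of_forall fun h => ?_)) (hVi.add (hR.const_mul _)) fun h => ?_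
        · rw [Real.norm_eq_abs, abs_of_nonneg (visits_nonneg B h)]
          exact visits_le B h
        · have h1 := abs_exp_sub_one_le (S h)
          have h2 : visits B h * |Real.exp (S h) - 1| ≤ T * |Real.exp (S h) - 1| :=
            mul_le_mul_of_nonneg_right (visits_le B h) (abs_nonneg _)
          have h3 := mul_le_mul_of_nonneg_left h1 (Nat.cast_nonneg (α := ℝ) T)
          have h4 := mul_le_mul_of_nonneg_left (le_abs_self (Real.exp (S h) - 1))
            (visits_nonneg B h)
          linarith
    _ = ∫ h, visits B h ∂P + T * (4 * (0 - ∫ h, S h ∂P) + 1 / 8 * 2) := by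
        rw [integral_add hVi (hR.const_mul _), integral_const_mul,
          integral_add (hR1.const_mul _) (hR2.const_mul _), integral_const_mul, integral_const_mul,
          integral_sub hE1i hS, integral_sub hEi (integrable_const _),
          integral_add (integrable_const _) hEi, hE1]
        simp
        norm_num
    _ ≤ _ := by
        have hSge' : -(δ ^ 2 / 2 * ∫ h, visits B h ∂P) ≤ ∫ h, S h ∂P := hSge
        have := mul_le_mul_of_nonneg_left hSge' (Nat.cast_nonneg (α := ℝ) T)
        linarith

/-- Pigeonhole: disjoint sets share the `T` steps, so one of them gets at most its part. -/
theorem exists_integral_visits_le {ι : Type*} [Fintype ι] [Nonempty ι] {B : ι → Set X}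
    (hBm : ∀ v, MeasurableSet (B v)) (hB : Pairwise fun v w => Disjoint (B v) (B w)) {T : ℕ}
    (μ : Measure (History X T)) [IsProbabilityMeasure μ] :
    ∃ v, ∫ h, visits (B v) h ∂μ ≤ T / Fintype.card ι := by
  have hsum : ∑ v, ∫ h, visits (B v) h ∂μ ≤ ∑ _v : ι, (T / Fintype.card ι : ℝ) := by
    rw [← integral_finsetSum _ fun v _ => integrable_visits (hBm v) μ]
    calc _ ≤ ∫ _h : History X T, (T : ℝ) ∂μ :=
          integral_mono (integrable_finsetSum _ fun v _ => integrable_visits (hBm v) μ)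
            (integrable_const _) fun h => sum_visits_le hB h
      _ = _ := by
          have : (Fintype.card ι : ℝ) ≠ 0 := by simp
          simp
          field_simp
  obtain ⟨v, -, hv⟩ := Finset.exists_le_of_sum_le Finset.univ_nonempty hsum
  exact ⟨v, hv⟩

/-- Regret accrues at a rate of at least `c` whenever the point chosen is outside `B`. The
bound `C` makes the regret integrable, so that its expectation is not a junk value. -/
theorem expectedRegret_ge (π : Policy X) {f : X → ℝ} (hf : Measurable f) {xs : X} {B : Set X}
    (hB : MeasurableSet B) {c C : ℝ} (hmin : ∀ x, f xs ≤ f x) (hC : ∀ x, f x - f xs ≤ C)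
    (hc : ∀ x, x ∉ B → c ≤ f x - f xs) (T : ℕ) :
    c * (T - ∫ h, visits B h ∂(historyLaw π f hf T)) ≤ expectedRegret π f hf xs T := by
  have hVi := integrable_visits hB (historyLaw π f hf T)
  have hRi : Integrable (regret f xs) (historyLaw π f hf T) := by
    refine integrable_finsetSum _ fun i _ => Integrable.of_bound (C := C) ?_
      (Filter.Eventually.of_forall fun h => ?_)
    · exact Measurable.aestronglyMeasurable (by fun_prop)
    · rw [Real.norm_eq_abs, abs_of_nonneg (sub_nonneg.2 (hmin _))]
      exact hC _
  have : c * (T - ∫ h, visits B h ∂(historyLaw π f hf T)) =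
      ∫ h, c * (T - visits B h) ∂(historyLaw π f hf T) := by
    rw [integral_const_mul, integral_sub (integrable_const _) hVi]
    simp
  rw [this, expectedRegret]
  refine integral_mono (((integrable_const _).sub hVi).const_mul _) hRi fun h => ?_
  have hT : c * (T - visits B h) =
      ∑ i, c * (1 - B.indicator (fun _ => (1 : ℝ)) (h i).1) := by
    rw [← Finset.mul_sum, Finset.sum_sub_distrib]
    simp [visits]
  rw [hT]
  refine Finset.sum_le_sum fun i _ => ?_
  by_cases hi : (h i).1 ∈ B
  · simpa [hi] using hmin _
  · simpa [hi] using hc _ hi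

end Law

/-! ### The doubling dimension of a cube -/

section Cube

variable {n : ℕ} {R : ℝ}

/-- The point of `ℝⁿ` whose coordinates are `a` or `-a`, according to `σ`. -/
def corner (a : ℝ) (σ : Fin n → Bool) : Fin n → ℝ := fun i => if σ i then a else -a

theorem abs_corner {a : ℝ} (ha : 0 ≤ a) (σ : Fin n → Bool) (i : Fin n) : |corner a σ i| = a := by
  unfold corner; split_ifs <;> simp [abs_of_nonneg ha]

theorem norm_corner_le {a : ℝ} (ha : 0 ≤ a) (σ : Fin n → Bool) : ‖corner a σ‖ ≤ a :=
  (pi_norm_le_iff_of_nonneg ha).2 fun i => (abs_corner ha σ i).le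

theorem corner_mem {a : ℝ} (ha : 0 ≤ a) (haR : a ≤ R) (σ : Fin n → Bool) :
    corner a σ ∈ Metric.closedBall (0 : Fin n → ℝ) R := by
  simpa using (norm_corner_le ha σ).trans haR

theorem le_dist_corner {a : ℝ} {σ τ : Fin n → Bool} (h : σ ≠ τ) :
    2 * a ≤ dist (corner a σ) (corner a τ) := by
  obtain ⟨i, hi⟩ := Function.ne_iff.1 h
  refine le_trans ?_ (dist_le_pi_dist _ _ i)
  rw [Real.dist_eq]
  cases h1 : σ i <;> cases h2 : τ i <;> simp_all [corner]
  · rw [abs_sub_comm]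
    exact le_trans (by linarith) (le_abs_self _)
  · exact le_trans (by linarith) (le_abs_self _)

/-- Each orthant of a ball of radius `r` is covered by a ball of radius `r / 2`; clamping its centre
into the cube brings it no further from any point of the cube. -/
theorem halvingCover_cube (hR : 0 ≤ R) :
    HalvingCover (Metric.closedBall (0 : Fin n → ℝ) R) (2 ^ n) := by
  classical
  intro x r hr
  have key : ∀ z : Fin n → ℝ, (∀ i, |z i| ≤ R) → z ∈ Metric.closedBall (0 : Fin n → ℝ) R := by
    intro z hz
    rw [mem_closedBall_zero_iff]
    exact (pi_norm_le_iff_of_nonneg hR).2 hz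
  have key' : ∀ z : Metric.closedBall (0 : Fin n → ℝ) R, ∀ i, |z.1 i| ≤ R := fun z i =>
    (norm_le_pi_norm z.1 i).trans (mem_closedBall_zero_iff.1 z.2)
  let c : (Fin n → Bool) → Metric.closedBall (0 : Fin n → ℝ) R := fun σ =>
    ⟨fun i => max (-R) (min R (x.1 i + corner (r / 2) σ i)), key _ fun i =>
      abs_le.2 ⟨le_max_left _ _, max_le (by linarith) (min_le_left _ _)⟩⟩
  refine ⟨Finset.univ.image c, Finset.card_image_le.trans (by simp), fun y hy => ?_⟩
  simp only [Finset.mem_image, Finset.mem_univ, true_and, Set.iUnion_exists, Set.iUnion_iUnion_eq',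
    Set.mem_iUnion]
  -- the orthant about `x` that contains `y`
  refine ⟨fun i => decide (x.1 i ≤ y.1 i), ?_⟩
  rw [Metric.mem_closedBall, Subtype.dist_eq, dist_pi_le_iff (by positivity)]
  intro i
  have hxy : |y.1 i - x.1 i| ≤ r := by
    rw [← Real.dist_eq]
    exact (dist_le_pi_dist y.1 x.1 i).trans hy
  have hy := abs_le.1 (key' y i)
  rw [abs_le] at hxy
  rw [Real.dist_eq, abs_le]
  simp only [c, corner, decide_eq_true_eq]
  split_ifs with h <;>
    rcases max_cases (-R) (min R _) with ⟨e, _⟩ | ⟨e, _⟩ <;> rw [e] <;>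
    rcases min_cases R _ with ⟨e', _⟩ | ⟨e', _⟩ <;> (try rw [e']) <;> constructor <;> linarith

/-- The corners of the cube are too far apart for two of them to share a ball of radius `R / 2`. -/
theorem two_pow_le_of_halvingCover_cube (hR : 0 < R) {N : ℕ}
    (hN : HalvingCover (Metric.closedBall (0 : Fin n → ℝ) R) N) : 2 ^ n ≤ N := by
  obtain ⟨C, hC, hcov⟩ := hN ⟨0, by simpa using hR.le⟩ R hR
  have hmem : ∀ σ : Fin n → Bool, ∃ c ∈ C, dist (corner R σ) c.1 ≤ R / 2 := by
    intro σ
    have := hcov (show (⟨corner R σ, corner_mem hR.le le_rfl σ⟩ :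
      Metric.closedBall (0 : Fin n → ℝ) R) ∈ Metric.closedBall _ R from
        corner_mem hR.le le_rfl σ)
    simpa [Subtype.dist_eq] using this
  choose c hcC hc using hmem
  have hinj : Function.Injective c := by
    intro σ τ h
    by_contra hne
    have h1 := le_dist_corner (a := R) hne
    have h2 := hc σ
    have h3 := hc τ
    rw [← h] at h3
    have h4 := dist_triangle_right (corner R σ) (corner R τ) (c σ).1
    linarith
  calc 2 ^ n = (Finset.univ : Finset (Fin n → Bool)).card := by simp
    _ ≤ C.card := Finset.card_le_card_of_injOn c (fun σ _ => hcC σ) hinj.injOn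
    _ ≤ N := hC

theorem doublingDim_cube (hR : 0 < R) :
    doublingDim (Metric.closedBall (0 : Fin n → ℝ) R) = n := by
  have : doublingConstant (Metric.closedBall (0 : Fin n → ℝ) R) = 2 ^ n :=
    le_antisymm (Nat.sInf_le (halvingCover_cube hR.le))
      (le_csInf ⟨_, halvingCover_cube hR.le⟩ fun _ hN => two_pow_le_of_halvingCover_cube hR hN)
  rw [doublingDim, this]
  push_cast
  rw [Real.logb_pow]
  simp

end Cube

/-! ### Losses with a hidden minimizer -/

section Spike

variable {n : ℕ} {R q ε : ℝ}

/-- The reference loss on the cube, `(ε + ‖x‖) ^ q`. -/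
noncomputable def baseLoss (q ε : ℝ) (x : Metric.closedBall (0 : Fin n → ℝ) R) : ℝ :=
  (ε + ‖x.1‖) ^ q

/-- The reference loss, replaced by `dist x p ^ q` on the ball of radius `ε` about `p`. It jumps at
the boundary of that ball, which nondegeneracy permits. -/
noncomputable def spikeLoss (q ε : ℝ) (p x : Metric.closedBall (0 : Fin n → ℝ) R) : ℝ :=
  open Classical in if x ∈ Metric.ball p ε then dist x p ^ q else baseLoss q ε x

theorem measurable_baseLoss :
    Measurable (baseLoss q ε : Metric.closedBall (0 : Fin n → ℝ) R → ℝ) := by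
  unfold baseLoss; fun_prop

theorem measurable_spikeLoss (p : Metric.closedBall (0 : Fin n → ℝ) R) :
    Measurable (spikeLoss q ε p) := by
  classical
  have : Measurable fun x => dist x p ^ q := by fun_prop
  exact Measurable.ite Metric.isOpen_ball.measurableSet this measurable_baseLoss

variable {p : Metric.closedBall (0 : Fin n → ℝ) R}

theorem norm_le_dist_add (hp : ‖p.1‖ ≤ ε) (x : Metric.closedBall (0 : Fin n → ℝ) R) :
    ‖x.1‖ ≤ dist x p + ε := by
  rw [Subtype.dist_eq, dist_eq_norm]
  linarith [norm_le_norm_sub_add x.1 p.1]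

theorem dist_rpow_le_spikeLoss (hq : 0 ≤ q) (hp : ‖p.1‖ ≤ ε)
    (x : Metric.closedBall (0 : Fin n → ℝ) R) : dist x p ^ q ≤ spikeLoss q ε p x := by
  unfold spikeLoss
  split_ifs with h
  · exact le_rfl
  · refine Real.rpow_le_rpow dist_nonneg ?_ hq
    rw [Subtype.dist_eq, dist_eq_norm]
    linarith [norm_sub_le x.1 p.1]

theorem spikeLoss_le (hq : 0 ≤ q) (hε : 0 ≤ ε) (hp : ‖p.1‖ ≤ ε)
    (x : Metric.closedBall (0 : Fin n → ℝ) R) : spikeLoss q ε p x ≤ 3 ^ q * dist x p ^ q := by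
  rw [← Real.mul_rpow (by norm_num) dist_nonneg]
  unfold spikeLoss
  split_ifs with h
  · exact Real.rpow_le_rpow dist_nonneg (by linarith [dist_nonneg (x := x) (y := p)]) hq
  · rw [Metric.mem_ball, not_lt] at h
    refine Real.rpow_le_rpow (by positivity) ?_ hq
    linarith [norm_le_dist_add hp x]

theorem spikeLoss_self (hq : 0 < q) (hε : 0 < ε) : spikeLoss q ε p p = 0 := by
  simp [spikeLoss, hε, Real.zero_rpow hq.ne']

theorem rpow_le_spikeLoss (hq : 0 ≤ q) (hε : 0 ≤ ε) {x : Metric.closedBall (0 : Fin n → ℝ) R}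
    (hx : x ∉ Metric.ball p ε) : ε ^ q ≤ spikeLoss q ε p x := by
  rw [spikeLoss, if_neg hx]
  exact Real.rpow_le_rpow hε (by linarith [norm_nonneg x.1]) hq

theorem spikeLoss_eq {x : Metric.closedBall (0 : Fin n → ℝ) R} (hx : x ∉ Metric.ball p ε) :
    spikeLoss q ε p x = baseLoss q ε x := if_neg hx

/-- On the ball of radius `ε` about `p` both losses lie between `0` and `(3 * ε) ^ q`. -/
theorem abs_spikeLoss_sub_le (hq : 0 ≤ q) (hε : 0 ≤ ε) (hp : ‖p.1‖ ≤ ε)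
    (x : Metric.closedBall (0 : Fin n → ℝ) R) :
    |spikeLoss q ε p x - baseLoss q ε x| ≤ 3 ^ q * ε ^ q := by
  rw [← Real.mul_rpow (by norm_num) hε]
  by_cases hx : x ∈ Metric.ball p ε
  · have h := Metric.mem_ball.1 hx
    refine abs_sub_le_of_nonneg_of_le ?_ ?_ ?_ ?_
    · rw [spikeLoss, if_pos hx]; positivity
    · rw [spikeLoss, if_pos hx]
      exact Real.rpow_le_rpow dist_nonneg (by linarith) hq
    · unfold baseLoss; positivity
    · exact Real.rpow_le_rpow (by positivity) (by linarith [norm_le_dist_add hp x]) hq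
  · rw [spikeLoss_eq hx, sub_self, abs_zero]
    positivity

theorem isNondegenerate_spikeLoss (hq : 1 ≤ q) (hε : 0 < ε) (hp : ‖p.1‖ ≤ ε) :
    IsNondegenerate (spikeLoss q ε p) p 1 (3 ^ q) q := by
  have hq0 : 0 < q := by linarith
  have h0 : spikeLoss q ε p p = 0 := spikeLoss_self hq0 hε
  refine ⟨one_pos, Real.one_le_rpow (by norm_num) hq0.le, hq, fun x hx => ?_, fun x => ?_,
    fun x => ?_⟩
  · rw [h0]
    exact (Real.rpow_pos_of_pos (dist_pos.2 hx) q).trans_le (dist_rpow_le_spikeLoss hq0.le hp x)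
  · rw [h0, sub_zero, one_mul]
    exact dist_rpow_le_spikeLoss hq0.le hp x
  · rw [h0, sub_zero]
    exact spikeLoss_le hq0.le hε.le hp x

/-- The lower bound at scale `ε`, provided `ε` is so small that `T / 2 ^ n` visits to a spike are too
few to reveal it. -/
theorem exists_expectedRegret_ge (hn : 1 ≤ n) (hq : 1 ≤ q) (hε : 0 < ε) (hεR : ε ≤ R) {T : ℕ}
    (hT : 1 ≤ T) (hδ : (3 ^ q * ε ^ q) ^ 2 * T ≤ 2 ^ n / 16)
    (π : Policy (Metric.closedBall (0 : Fin n → ℝ) R)) :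
    ∃ (f : Metric.closedBall (0 : Fin n → ℝ) R → ℝ) (hf : Measurable f)
      (xs : Metric.closedBall (0 : Fin n → ℝ) R),
      IsNondegenerate f xs 1 (3 ^ q) q ∧ ε ^ q * T / 8 ≤ expectedRegret π f hf xs T := by
  have hq0 : 0 < q := by linarith
  let p : (Fin n → Bool) → Metric.closedBall (0 : Fin n → ℝ) R :=
    fun σ => ⟨corner ε σ, corner_mem hε.le hεR σ⟩
  have hp : ∀ σ, ‖(p σ).1‖ ≤ ε := norm_corner_le hε.le
  have hdisj : Pairwise fun σ τ => Disjoint (Metric.ball (p σ) ε) (Metric.ball (p τ) ε) :=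
    fun σ τ h => Metric.ball_disjoint_ball (by
      have := le_dist_corner (a := ε) h
      rw [Subtype.dist_eq]
      linarith)
  have hball : ∀ σ, MeasurableSet (Metric.ball (p σ) ε) := fun σ => Metric.isOpen_ball.measurableSet
  obtain ⟨σ, hσ⟩ := exists_integral_visits_le hball hdisj
    (historyLaw π (baseLoss q ε) measurable_baseLoss T)
  refine ⟨spikeLoss q ε (p σ), measurable_spikeLoss _, p σ,
    isNondegenerate_spikeLoss hq hε (hp σ), ?_⟩
  have hinfo := integral_visits_le π (measurable_spikeLoss (p σ)) measurable_baseLoss (hball σ)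
    (abs_spikeLoss_sub_le hq0.le hε.le (hp σ)) (fun x hx => spikeLoss_eq hx) T
  have h0 : spikeLoss q ε (p σ) (p σ) = 0 := spikeLoss_self hq0 hε
  have hreg := expectedRegret_ge π (measurable_spikeLoss (p σ)) (xs := p σ) (hball σ) (c := ε ^ q)
    (C := 3 ^ q * (2 * R) ^ q)
    (fun x => h0.trans_le ((by positivity : 0 ≤ dist x (p σ) ^ q).trans
      (dist_rpow_le_spikeLoss hq0.le (hp σ) x)))
    (fun x => by
      rw [h0, sub_zero]
      refine (spikeLoss_le hq0.le hε.le (hp σ) x).trans ?_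
      gcongr
      have h1 := Metric.mem_closedBall.1 x.2
      have h2 := Metric.mem_closedBall.1 (p σ).2
      rw [Subtype.dist_eq]
      linarith [dist_triangle_right x.1 (p σ).1 0])
    (fun x hx => by rw [h0, sub_zero]; exact rpow_le_spikeLoss hq0.le hε.le hx) T
  refine le_trans ?_ hreg
  set V := ∫ h, visits (Metric.ball (p σ) ε) h ∂(historyLaw π (baseLoss q ε) measurable_baseLoss T)
  have hT0 : (0 : ℝ) < T := by exact_mod_cast hT
  have hN : (2 : ℝ) ≤ 2 ^ n := by
    calc (2 : ℝ) = 2 ^ 1 := by norm_num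
      _ ≤ 2 ^ n := pow_le_pow_right₀ (by norm_num) hn
  have hV : V ≤ T / 2 ^ n := by simpa using hσ
  have hV2 : V ≤ T / 2 := hV.trans (by gcongr)
  have hKL : 2 * (3 ^ q * ε ^ q) ^ 2 * V ≤ 1 / 8 := by
    calc 2 * (3 ^ q * ε ^ q) ^ 2 * V ≤ 2 * (3 ^ q * ε ^ q) ^ 2 * (T / 2 ^ n) := by gcongr
      _ = 2 / 2 ^ n * ((3 ^ q * ε ^ q) ^ 2 * T) := by ring
      _ ≤ 2 / 2 ^ n * (2 ^ n / 16) := by gcongr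
      _ = 1 / 8 := by field_simp; norm_num
  have := mul_le_mul_of_nonneg_left hKL hT0.le
  have hεq : 0 < ε ^ q := Real.rpow_pos_of_pos hε q
  rw [mul_div_assoc]
  refine mul_le_mul_of_nonneg_left ?_ hεq.le
  linarith

end Spike
end NondegBandit

theorem theorem2 :
    ∃ A : ℝ, 1 < A ∧
    ∀ q : ℝ, 1 ≤ q →
    ∃ K lam L : ℝ, 0 < K ∧ 0 < lam ∧ lam ≤ L ∧
    ∀ d : ℝ, 1 ≤ d →
    ∃ X₀ : Set (Fin ⌊d⌋₊ → ℝ),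
      CompactSpace X₀ ∧ NondegBandit.IsDoubling X₀ ∧
      NondegBandit.doublingDim X₀ = (⌊d⌋₊ : ℝ) ∧
      ∀ T : ℕ, 1 ≤ T →
      ∀ π : NondegBandit.Policy X₀,
      ∃ (f : X₀ → ℝ) (hf : Measurable f) (xs : X₀),
        NondegBandit.IsNondegenerate f xs lam L q ∧
        K * A ^ ⌊d⌋₊ * √(T : ℝ) ≤ NondegBandit.expectedRegret π f hf xs T := by
  refine ⟨√2, Real.lt_sqrt_of_sq_lt (by norm_num), fun q hq => ?_⟩
  have hq0 : 0 < q := by linarith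
  have h3 : (1 : ℝ) ≤ 3 ^ q := Real.one_le_rpow (by norm_num) hq0.le
  refine ⟨1 / (32 * 3 ^ q), 1, 3 ^ q, by positivity, one_pos, h3, fun d hd => ?_⟩
  have hn : 1 ≤ ⌊d⌋₊ := Nat.le_floor (by simpa using hd)
  set n := ⌊d⌋₊
  have hR : 0 < (√2 ^ n) ^ (1 / q) := by positivity
  refine ⟨Metric.closedBall 0 ((√2 ^ n) ^ (1 / q)),
    isCompact_iff_compactSpace.1 (isCompact_closedBall _ _),
    ⟨_, NondegBandit.halvingCover_cube hR.le⟩, NondegBandit.doublingDim_cube hR,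
    fun T hT π => ?_⟩
  have hT1 : (1 : ℝ) ≤ T := by exact_mod_cast hT
  have hsT1 : 1 ≤ √(T : ℝ) := Real.one_le_sqrt.2 hT1
  -- The gap `a = ε ^ q` is, up to a constant factor, the largest that stays hidden for `T` steps.
  set a : ℝ := √2 ^ n / (4 * 3 ^ q * √T) with ha
  have ha0 : 0 < a := by positivity
  have haq : (a ^ (1 / q)) ^ q = a := by
    rw [← Real.rpow_mul ha0.le, one_div_mul_cancel hq0.ne', Real.rpow_one]
  have hsq : (√2 ^ n) ^ 2 = (2 : ℝ) ^ n := by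
    rw [← pow_mul, mul_comm, pow_mul, Real.sq_sqrt (by norm_num)]
  obtain ⟨f, hf, xs, hnd, hreg⟩ := NondegBandit.exists_expectedRegret_ge (n := n)
    (R := (√2 ^ n) ^ (1 / q)) (ε := a ^ (1 / q)) hn hq (by positivity)
    (Real.rpow_le_rpow ha0.le (div_le_self (by positivity) (by nlinarith)) (by positivity)) hT
    (by
      rw [haq, ha]
      have : (3 ^ q * (√2 ^ n / (4 * 3 ^ q * √T))) ^ 2 * (T : ℝ) =
          (√2 ^ n) ^ 2 / 16 * (T / √T ^ 2) := by
        field_simp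
        norm_num
      rw [this, hsq, Real.sq_sqrt (by positivity), div_self (by positivity), mul_one]) π
  refine ⟨f, hf, xs, hnd, le_trans (le_of_eq ?_) hreg⟩
  rw [haq, ha]
  nth_rewrite 3 [← Real.sq_sqrt (Nat.cast_nonneg (α := ℝ) T)]
  field_simp
  norm_num
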